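/- Let $m\ge 2$, $\mathbf x=(x_1,\dots,x_{m-1})$, and let $h(\mathbf x,y,z)$ be an $(m-1)\times1\times1$ degenerated tripartite quartic form, i.e. a real quartic form in the $m+1$ variables $(\mathbf x,y,z)$ such that in every term the total degree in the $x$-variables is at most $2$ and the degree in $y$ is at most $2$, the coefficient of $z^4$ is $0$, and $h$ is psd (nonnegative on $\mathbb R^{m+1}$). Then $h$ can be written as $$h(\mathbf x,y,z)=h_2(\mathbf x)z^2+h_3(\mathbf x)yz+h_4(\mathbf x)y^2+h_5(\mathbf x)yz^2+h_6(\mathbf x)y^2z+h_7y^2z^2,$$ where $h_2,h_3,h_4$ are quadratic forms in $\mathbf x$, $h_5,h_6$ are linear forms in $\mathbf x$ and $h_7$ is a real constant (forms may be zero), and for every such expression the following hold. (i) $h_7\ge 0$. If $h_7=0$, then $h_5\equiv0$ and $h_6\equiv0$. (ii) $h_2$ is a sum of squares of $m-1$ linear forms in $\mathbf x$. If $h_2\equiv0$, then $h_3\equiv0$ and $h_5\equiv0$. (iii) $h_4$ is a sum of squares of $m-1$ linear forms in $\mathbf x$. If $h_4\equiv0$, then $h_3\equiv0$ and $h_6\equiv0$.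 (iv) $h_2(\mathbf x)+h_5(\mathbf x)y+h_7y^2$ is a sum of squares of $m$ linear forms in $(\mathbf x,y)$, and $h_4(\mathbf x)+h_6(\mathbf x)z+h_7z^2$ is a sum of squares of $m$ linear forms in $(\mathbf x,z)$. (v) $h_2(\mathbf x)z^2+h_3(\mathbf x)yz+h_4(\mathbf x)y^2$ is a sum of squares (sos) of quadratic forms, and its sos rank (the minimum number of squares in such an expression) is at most $2(m-1)$. (vi) $h$ has at least two nontrivial zeros: $(\mathbf x,y,z)=(\mathbf 0,1,0)$ and $(\mathbf x,y,z)=(\mathbf 0,0,1)$. In (ii)–(iv), some of the linear forms are allowed to be zero. -/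

import Mathlib

open MvPolynomial

noncomputable section

/-- The variables `(x, y, z)` of a `p × n × 1` tripartite form: `p` variables `x i`,
`n` variables `y j` and one complementary variable `z`. -/
abbrev TriVar (p n : ℕ) : Type := Fin p ⊕ (Fin n ⊕ Unit)

namespace TriVar

/-- The variable `x i`. -/
abbrev x {p n : ℕ} (i : Fin p) : TriVar p n := Sum.inl i

/-- The variable `y j`. -/
abbrev y {p n : ℕ} (j : Fin n) : TriVar p n := Sum.inr (Sum.inl j)

/-- The complementary variable `z`. -/
abbrev z {p n : ℕ} : TriVar p n := Sum.inr (Sum.inr ())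

/-- The point `(x, y, z)` with the given coordinates. -/
def point {p n : ℕ} (a : Fin p → ℝ) (b : Fin n → ℝ) (c : ℝ) : TriVar p n → ℝ :=
  Sum.elim a (Sum.elim b (fun _ => c))

end TriVar

/-- A real polynomial is positive semi-definite if all its values are nonnegative. -/
def IsPSD {σ : Type*} (f : MvPolynomial σ ℝ) : Prop :=
  ∀ v : σ → ℝ, 0 ≤ eval v f

/-- A `p × n × 1` tripartite quartic form: a quartic form in each term of which the total degree
of the `x`-variables is at most `2` and the total degree of the `y`-variables is at most `2`. -/
def IsTripartiteQuarticForm {p n : ℕ} (h : MvPolynomial (TriVar p n) ℝ) : Prop :=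
  h.IsHomogeneous 4 ∧
    ∀ s ∈ h.support, ∑ i, s (TriVar.x i) ≤ 2 ∧ ∑ j, s (TriVar.y j) ≤ 2

/-- A degenerated tripartite quartic form: it is psd and its coefficient of `z ^ 4` is zero. -/
def IsDegenerated {p n : ℕ} (h : MvPolynomial (TriVar p n) ℝ) : Prop :=
  IsTripartiteQuarticForm h ∧ coeff (Finsupp.single TriVar.z 4) h = 0 ∧ IsPSD h

/-- `f` is a sum of squares of `k` forms of degree `d` (some of which may be zero). -/
def IsSumOfSquaresOfForms {σ : Type*} (d k : ℕ) (f : MvPolynomial σ ℝ) : Prop :=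
  ∃ q : Fin k → MvPolynomial σ ℝ, (∀ i, (q i).IsHomogeneous d) ∧ f = ∑ i, q i ^ 2

/-- A quartic form is sos if it is a finite sum of squares of quadratic forms. -/
def IsSOS {σ : Type*} (f : MvPolynomial σ ℝ) : Prop :=
  ∃ k, IsSumOfSquaresOfForms 2 k f

/-- The sos rank of an sos quartic form: the minimum number of squares in an sos expression. -/
def sosRank {σ : Type*} (f : MvPolynomial σ ℝ) : ℕ :=
  sInf {k | IsSumOfSquaresOfForms 2 k f}

/-- The part `h₂(x) z² + h₃(x) y z + h₄(x) y²`. -/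
def biquadraticPart {p : ℕ} (h₂ h₃ h₄ : MvPolynomial (Fin p) ℝ) :
    MvPolynomial (TriVar p 1) ℝ :=
  rename TriVar.x h₂ * X TriVar.z ^ 2
    + rename TriVar.x h₃ * X (TriVar.y 0) * X TriVar.z
    + rename TriVar.x h₄ * X (TriVar.y 0) ^ 2

/-- `h(x,y,z) = h₂(x) z² + h₃(x) y z + h₄(x) y² + h₅(x) y z² + h₆(x) y² z + h₇ y² z²` with
quadratic forms `h₂, h₃, h₄`, linear forms `h₅, h₆` and a constant `h₇`. -/
structure IsExpressedBy {p : ℕ} (h : MvPolynomial (TriVar p 1) ℝ)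
    (h₂ h₃ h₄ h₅ h₆ : MvPolynomial (Fin p) ℝ) (h₇ : ℝ) : Prop where
  quadratic₂ : h₂.IsHomogeneous 2
  quadratic₃ : h₃.IsHomogeneous 2
  quadratic₄ : h₄.IsHomogeneous 2
  linear₅ : h₅.IsHomogeneous 1
  linear₆ : h₆.IsHomogeneous 1
  eq : h = biquadraticPart h₂ h₃ h₄
    + rename TriVar.x h₅ * X (TriVar.y 0) * X TriVar.z ^ 2
    + rename TriVar.x h₆ * X (TriVar.y 0) ^ 2 * X TriVar.z
    + C h₇ * X (TriVar.y 0) ^ 2 * X TriVar.z ^ 2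

/-- The quadratic form `q(x) + l(x) t + c t²` in the variables `x 0, …, x (p-1), t`,
where `t` is the variable `Sum.inr ()`. -/
def borderedQuadratic {p : ℕ} (q l : MvPolynomial (Fin p) ℝ) (c : ℝ) :
    MvPolynomial (Fin p ⊕ Unit) ℝ :=
  rename Sum.inl q + rename Sum.inl l * X (Sum.inr ()) + C c * X (Sum.inr ()) ^ 2

/-- `v` is a nontrivial zero of `f`. -/
def IsNontrivialZero {σ : Type*} (f : MvPolynomial σ ℝ) (v : σ → ℝ) : Prop :=
  v ≠ 0 ∧ eval v f = 0

end

/-! ### Positive semidefinite Gram matrices by duality -/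

section GramMatrix

open Matrix
open scoped MatrixOrder

variable {n : Type*} [Fintype n] [DecidableEq n]

/-! Apart from (v), everything comes from restricting `h` to curves. Scaling `(y, z)` to zero
isolates the biquadratic part; sending `z` (or `y`) to infinity isolates the two bordered
quadratics. So these are psd, and a psd quadratic form in k variables is a sum of k squares. The
vanishing claims hold because a polynomial `b t + c t²` that is nonnegative everywhere has `b = 0`.

The substance of (v) is that a psd quadratic matrix polynomial `A + sB + s²C` has a psd Gram matrix
(`Matrix.exists_posSemidef_gram`); a Gram matrix of size 2p yields 2p squares. If none existed,
Hahn–Banach would give a functional, represented by a positive definite block Hankel matrix with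
blocks `P, R, R, Q`, that is negative at `(A, B, C)`. Write `P = T Tᵀ` and `R = T D Tᵀ` with `D`
diagonal. The Schur complement gives `Q ≥ T D² Tᵀ`, so the functional is at least a sum of values of
the matrix polynomial at the points `dᵢ`, tested on the columns of `T`. Hence it is nonnegative, a
contradiction. -/

theorem Matrix.PosSemidef.exists_transpose_mul_self {A : Matrix n n ℝ} (hA : A.PosSemidef) :
    ∃ B : Matrix n n ℝ, A = Bᵀ * B := by
  obtain ⟨B, hB⟩ := CStarAlgebra.nonneg_iff_eq_star_mul_self.mp hA.nonneg
  exact ⟨B, by rw [hB, star_eq_conjTranspose, conjTranspose_eq_transpose_of_trivial]⟩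

theorem Matrix.PosSemidef.trace_mul_nonneg {A B : Matrix n n ℝ} (hA : A.PosSemidef)
    (hB : B.PosSemidef) : 0 ≤ (A * B).trace := by
  obtain ⟨C, rfl⟩ := hA.exists_transpose_mul_self
  rw [Matrix.mul_assoc, Matrix.trace_mul_comm, ← conjTranspose_eq_transpose_of_trivial]
  exact (hB.mul_mul_conjTranspose_same C).trace_nonneg

/-- Simultaneous diagonalization of a positive definite and a symmetric matrix. -/
theorem Matrix.PosDef.exists_simultaneous_diagonalization {P R : Matrix n n ℝ} (hP : P.PosDef)
    (hR : R.IsHermitian) :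
    ∃ (T : Matrix n n ℝ) (d : n → ℝ), IsUnit T ∧ P = T * Tᵀ ∧ R = T * diagonal d * Tᵀ := by
  obtain ⟨S, hS⟩ := hP.posSemidef.exists_transpose_mul_self
  have hSu : IsUnit S := by
    have h := hP.isUnit
    rw [hS] at h
    rw [Matrix.isUnit_iff_isUnit_det] at h ⊢
    rw [det_mul] at h
    exact isUnit_of_mul_isUnit_right h
  have hSd := (Matrix.isUnit_iff_isUnit_det S).1 hSu
  have hK : (S⁻¹ᵀ * R * S⁻¹).IsHermitian := by
    have := isHermitian_conjTranspose_mul_mul S⁻¹ hR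
    rwa [conjTranspose_eq_transpose_of_trivial] at this
  obtain ⟨O, d, hO, hO', hd⟩ : ∃ (O : Matrix n n ℝ) (d : n → ℝ), IsUnit O ∧ O * Oᵀ = 1 ∧
      S⁻¹ᵀ * R * S⁻¹ = O * diagonal d * Oᵀ := by
    refine ⟨hK.eigenvectorUnitary, hK.eigenvalues, Unitary.isUnit_coe, ?_, ?_⟩
    · have := Unitary.coe_mul_star_self hK.eigenvectorUnitary
      rwa [Unitary.coe_star, star_eq_conjTranspose,
        conjTranspose_eq_transpose_of_trivial] at this
    · have := hK.spectral_theorem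
      rwa [Unitary.conjStarAlgAut_apply, star_eq_conjTranspose,
        conjTranspose_eq_transpose_of_trivial] at this
  refine ⟨Sᵀ * O, d, ?_, ?_, ?_⟩
  · exact ((Matrix.isUnit_transpose _).2 hSu).mul hO
  · rw [transpose_mul, transpose_transpose, Matrix.mul_assoc, ← Matrix.mul_assoc O, hO',
      Matrix.one_mul, hS]
  · have h1 : Sᵀ * (S⁻¹ᵀ * R * S⁻¹) * S = R := by
      have h2 : Sᵀ * S⁻¹ᵀ = 1 := by
        rw [← transpose_mul, Matrix.nonsing_inv_mul _ hSd, transpose_one]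
      calc _ = (Sᵀ * S⁻¹ᵀ) * R * (S⁻¹ * S) := by simp only [Matrix.mul_assoc]
        _ = R := by rw [h2, Matrix.nonsing_inv_mul _ hSd, Matrix.one_mul, Matrix.mul_one]
    rw [← h1, hd, transpose_mul, transpose_transpose]
    simp only [Matrix.mul_assoc]

/-- A positive definite block Hankel form is nonnegative on matrix polynomials of degree two
that are positive semidefinite on the projective line. -/
theorem Matrix.trace_add_trace_add_trace_nonneg {P R Q A B C : Matrix n n ℝ} (hP : P.PosDef)
    (hM : (fromBlocks P R R Q).PosSemidef)
    (hABC : ∀ s : ℝ, (A + s • B + s ^ 2 • C).PosSemidef) (hC : C.PosSemidef) :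
    0 ≤ (P * A).trace + (R * B).trace + (Q * C).trace := by
  have hR : Rᴴ = R := ((isHermitian_fromBlocks_iff).1 hM.1).2.1
  obtain ⟨T, d, hT, rfl, hRT⟩ := hP.exists_simultaneous_diagonalization hR
  have hTd := (Matrix.isUnit_iff_isUnit_det T).1 hT
  -- Schur complement: `R P⁻¹ R` collapses to `T D² Tᵀ`.
  have hQ : (Q - T * diagonal (fun i => d i ^ 2) * Tᵀ).PosSemidef := by
    have := hP.isUnit.invertible
    have h := (PosDef.fromBlocks₁₁ R Q hP).1 (by rwa [hR])
    have e : Rᴴ * (T * Tᵀ)⁻¹ * R = T * diagonal (fun i => d i ^ 2) * Tᵀ := by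
      have h2 : Tᵀ * Tᵀ⁻¹ = 1 := Matrix.mul_nonsing_inv _ (by rwa [det_transpose])
      rw [hR, hRT, Matrix.mul_inv_rev]
      calc _ = T * diagonal d * (Tᵀ * Tᵀ⁻¹) * (T⁻¹ * T) * diagonal d * Tᵀ := by
            simp only [Matrix.mul_assoc]
        _ = T * (diagonal d * diagonal d) * Tᵀ := by
            rw [h2, Matrix.nonsing_inv_mul _ hTd]; simp only [Matrix.mul_assoc, Matrix.one_mul]
        _ = _ := by rw [diagonal_mul_diagonal]; simp only [sq]
    rwa [e] at h
  have h1 := hQ.trace_mul_nonneg hC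
  have key : ∀ (e : n → ℝ) (D : Matrix n n ℝ),
      (T * diagonal e * Tᵀ * D).trace = ∑ i, e i * (Tᵀ * D * T) i i := by
    intro e D
    rw [Matrix.mul_assoc, Matrix.mul_assoc, Matrix.trace_mul_comm]
    simp only [Matrix.mul_assoc, Matrix.trace, diag_apply, diagonal_mul]
  have hP' : T * Tᵀ = T * diagonal (fun _ => (1 : ℝ)) * Tᵀ := by
    rw [diagonal_one, Matrix.mul_one]
  rw [Matrix.sub_mul, trace_sub, key] at h1
  rw [hP', hRT, key, key]
  -- The i-th term is the matrix polynomial at `s = d i`, tested on the i-th column of `T`.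
  have h2 : 0 ≤ ∑ i, (1 * (Tᵀ * A * T) i i + d i * (Tᵀ * B * T) i i
      + d i ^ 2 * (Tᵀ * C * T) i i) := by
    refine Finset.sum_nonneg fun i _ => ?_
    have h3 := ((hABC (d i)).conjTranspose_mul_mul_same T).diag_nonneg (i := i)
    rw [conjTranspose_eq_transpose_of_trivial] at h3
    simpa [Matrix.mul_add, Matrix.add_mul] using h3
  simp only [Finset.sum_add_distrib] at h2
  linarith

/-- Riesz representation for the trace pairing; symmetrizing the representing matrix does not change
its pairing with symmetric matrices. -/
theorem Matrix.exists_isHermitian_forall_apply_eq_trace_mul (φ : Matrix n n ℝ →ₗ[ℝ] ℝ) :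
    ∃ P : Matrix n n ℝ, P.IsHermitian ∧ ∀ A : Matrix n n ℝ, A.IsHermitian →
      φ A = (P * A).trace := by
  have h0 : ∀ A : Matrix n n ℝ, φ A = (of (fun i j => φ (single j i 1)) * A).trace := by
    intro A
    conv_lhs => rw [matrix_eq_sum_single A]
    simp only [map_sum, Matrix.trace, diag_apply, mul_apply, of_apply]
    rw [Finset.sum_comm]
    refine Finset.sum_congr rfl fun i _ => Finset.sum_congr rfl fun j _ => ?_
    have : single j i (A j i) = A j i • single j i (1 : ℝ) := by simp
    rw [this, map_smul, smul_eq_mul, mul_comm]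
  set P₀ : Matrix n n ℝ := of (fun i j => φ (single j i 1))
  refine ⟨(1 / 2 : ℝ) • (P₀ + P₀ᵀ), ?_, fun A hA => ?_⟩
  · rw [IsHermitian, conjTranspose_eq_transpose_of_trivial]
    simp [add_comm]
  · have hA' : Aᵀ = A := by
      rwa [IsHermitian, conjTranspose_eq_transpose_of_trivial] at hA
    have h1 : (P₀ᵀ * A).trace = (P₀ * A).trace := by
      rw [← trace_transpose, transpose_mul, transpose_transpose, hA', trace_mul_comm]
    rw [h0, smul_mul, trace_smul, Matrix.add_mul, trace_add, h1, smul_eq_mul]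
    ring

theorem Matrix.isCompact_setOf_posSemidef_trace_eq (c : ℝ) :
    IsCompact {G : Matrix n n ℝ | G.PosSemidef ∧ G.trace = c} := by
  refine IsCompact.of_isClosed_subset
    (isCompact_univ_pi fun _ => isCompact_univ_pi fun _ => isCompact_Icc (a := -c) (b := c)) ?_ ?_
  · have : {G : Matrix n n ℝ | G.PosSemidef ∧ G.trace = c} =
        {G | Gᵀ = G} ∩ (⋂ x : n → ℝ, {G | 0 ≤ x ⬝ᵥ (G *ᵥ x)}) ∩ {G | G.trace = c} := by
      ext G
      simp [posSemidef_iff_dotProduct_mulVec, IsHermitian, conjTranspose_eq_transpose_of_trivial]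
    rw [this]
    refine ((isClosed_eq (by fun_prop) (by fun_prop)).inter
      (isClosed_iInter fun x => isClosed_le (by fun_prop) (by fun_prop))).inter
        (isClosed_eq (by fun_prop) (by fun_prop))
  · rintro G ⟨hG, rfl⟩ i - j -
    have hd : ∀ i, G i i ≤ G.trace := fun i =>
      Finset.single_le_sum (f := fun i => G i i) (fun k _ => hG.diag_nonneg) (Finset.mem_univ i)
    have hs : G j i = G i j := by simpa using hG.1.apply i j
    -- Testing on `eᵢ ± eⱼ` gives `2|Gᵢⱼ| ≤ Gᵢᵢ + Gⱼⱼ`, which bounds every entry by the trace.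
    have h1 := hG.dotProduct_mulVec_nonneg (Pi.single i 1 + Pi.single j 1)
    have h2 := hG.dotProduct_mulVec_nonneg (Pi.single i 1 - Pi.single j 1)
    simp [mulVec_add, mulVec_sub, dotProduct_add, dotProduct_sub, add_dotProduct, sub_dotProduct] at h1 h2
    have := hd i
    have := hd j
    constructor <;> linarith

/-- A symmetric matrix polynomial of degree two that is positive semidefinite on the projective line
has a positive semidefinite Gram matrix. -/
theorem Matrix.exists_posSemidef_gram {A B C : Matrix n n ℝ} (hB : B.IsHermitian)
    (hABC : ∀ s : ℝ, (A + s • B + s ^ 2 • C).PosSemidef) (hC : C.PosSemidef) :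
    ∃ G : Matrix (n ⊕ n) (n ⊕ n) ℝ, G.PosSemidef ∧ G.toBlocks₁₁ = A ∧
      G.toBlocks₁₂ + G.toBlocks₂₁ = B ∧ G.toBlocks₂₂ = C := by
  have hA : A.PosSemidef := by simpa using hABC 0
  -- Every Gram matrix of `(A, B, C)` has trace `c`, so fixing the trace loses nothing and makes the
  -- candidate set compact. The case `c = 0` is separate because `c` is divided by below.
  set c : ℝ := A.trace + C.trace with hc
  rcases (add_nonneg hA.trace_nonneg hC.trace_nonneg).eq_or_lt with h0 | h0
  · have hA0 : A = 0 := hA.trace_eq_zero_iff.1 (by linarith [hA.trace_nonneg, hC.trace_nonneg])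
    have hC0 : C = 0 := hC.trace_eq_zero_iff.1 (by linarith [hA.trace_nonneg, hC.trace_nonneg])
    subst hA0 hC0
    have h1 : B.PosSemidef := by simpa using hABC 1
    have h2 : (-B).PosSemidef := by simpa using hABC (-1)
    have h3 := h2.trace_nonneg
    rw [trace_neg] at h3
    have hB0 : B = 0 := h1.trace_eq_zero_iff.1 (by linarith [h1.trace_nonneg])
    subst hB0
    exact ⟨0, .zero, rfl, by ext; simp [toBlocks₁₂, toBlocks₂₁], rfl⟩
  let Φ : Matrix (n ⊕ n) (n ⊕ n) ℝ →ₗ[ℝ] Matrix n n ℝ × Matrix n n ℝ × Matrix n n ℝ :=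
    { toFun := fun G => (G.toBlocks₁₁, G.toBlocks₁₂ + G.toBlocks₂₁, G.toBlocks₂₂)
      map_add' := fun G H => by
        ext <;> simp [toBlocks₁₁, toBlocks₁₂, toBlocks₂₁, toBlocks₂₂]
        ring
      map_smul' := fun r G => by
        ext <;> simp [toBlocks₁₁, toBlocks₁₂, toBlocks₂₁, toBlocks₂₂] }
  set K : Set (Matrix (n ⊕ n) (n ⊕ n) ℝ) := {G | G.PosSemidef ∧ G.trace = c}
  have hKc : Convex ℝ K := by
    rintro G ⟨hG, hGt⟩ H ⟨hH, hHt⟩ a b ha hb hab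
    refine ⟨(hG.smul ha).add (hH.smul hb), ?_⟩
    rw [trace_add, trace_smul, trace_smul, hGt, hHt, ← add_smul, hab, one_smul]
  have hΦc : Continuous Φ := Φ.continuous_of_finiteDimensional
  by_cases hmem : (A, B, C) ∈ Φ '' K
  · obtain ⟨G, ⟨hG, -⟩, hGe⟩ := hmem
    simp only [Φ, LinearMap.coe_mk, AddHom.coe_mk, Prod.mk.injEq] at hGe
    exact ⟨G, hG, hGe⟩
  exfalso
  have : LocallyConvexSpace ℝ (Matrix n n ℝ) :=
    inferInstanceAs (LocallyConvexSpace ℝ (n → n → ℝ))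
  obtain ⟨l, u, hlt, hlK⟩ := geometric_hahn_banach_point_closed (hKc.linear_image Φ)
    ((isCompact_setOf_posSemidef_trace_eq c).image hΦc).isClosed hmem
  -- Subtracting `u / c` times the trace moves the separating threshold `u` to zero on matrices of
  -- trace `c`.
  obtain ⟨P, hP, hPA⟩ := exists_isHermitian_forall_apply_eq_trace_mul
    (l.toLinearMap ∘ₗ LinearMap.inl ℝ _ _ - (u / c) • traceLinearMap n ℝ ℝ)
  obtain ⟨R, hR, hRA⟩ := exists_isHermitian_forall_apply_eq_trace_mul
    (l.toLinearMap ∘ₗ LinearMap.inr ℝ _ _ ∘ₗ LinearMap.inl ℝ _ _)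
  obtain ⟨Q, hQ, hQA⟩ := exists_isHermitian_forall_apply_eq_trace_mul
    (l.toLinearMap ∘ₗ LinearMap.inr ℝ _ _ ∘ₗ LinearMap.inr ℝ _ _ - (u / c) • traceLinearMap n ℝ ℝ)
  have hL : ∀ D E F : Matrix n n ℝ, D.IsHermitian → E.IsHermitian → F.IsHermitian →
      (P * D).trace + (R * E).trace + (Q * F).trace
        = l (D, E, F) - u / c * (D.trace + F.trace) := by
    intro D E F hD hE hF
    rw [← hPA D hD, ← hRA E hE, ← hQA F hF]
    have : l (D, E, F) = l (D, 0) + l (0, E, 0) + l (0, 0, F) := by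
      rw [← map_add, ← map_add]; simp
    rw [this]
    simp
    ring
  -- The quadratic form at `x` is the shifted functional at the rank-one Gram matrix `x xᵀ`, which
  -- is rescaled to trace `c` to lie in `K`.
  have hM : (fromBlocks P R R Q).PosDef := by
    refine .of_dotProduct_mulVec_pos ?_ fun x hx => ?_
    · exact isHermitian_fromBlocks_iff.2 ⟨hP, hR, hR, hQ⟩
    · have hxx : 0 < x ⬝ᵥ x := by simpa using dotProduct_star_self_pos_iff.2 hx
      set r : ℝ := c / (x ⬝ᵥ x)
      have hr : 0 < r := div_pos h0 hxx
      have hK : r • vecMulVec x x ∈ K := by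
        refine ⟨PosSemidef.smul (by simpa using posSemidef_vecMulVec_self_star x) hr.le, ?_⟩
        rw [trace_smul, trace_vecMulVec, smul_eq_mul, div_mul_cancel₀ _ hxx.ne']
      have h1 := hlK _ ⟨_, hK, rfl⟩
      rw [map_smul, map_smul, smul_eq_mul] at h1
      set v : n → ℝ := x ∘ Sum.inl
      set w : n → ℝ := x ∘ Sum.inr
      have hΦ : Φ (vecMulVec x x) =
          (vecMulVec v v, vecMulVec v w + vecMulVec w v, vecMulVec w w) := rfl
      have hsym : ∀ y : n → ℝ, (vecMulVec y y).IsHermitian := fun y => by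
        ext i j; simp [vecMulVec, mul_comm]
      have h2 := hL (vecMulVec v v) (vecMulVec v w + vecMulVec w v) (vecMulVec w w) (hsym v)
        (by ext i j; simp [vecMulVec, mul_comm, add_comm]) (hsym w)
      have hx' : x = Sum.elim v w := (Sum.elim_comp_inl_inr x).symm
      have h3 : star x ⬝ᵥ fromBlocks P R R Q *ᵥ x = (P * vecMulVec v v).trace
          + (R * (vecMulVec v w + vecMulVec w v)).trace + (Q * vecMulVec w w).trace := by
        rw [star_trivial, fromBlocks_mulVec]
        conv_lhs => enter [1]; rw [hx']
        simp only [sumElim_dotProduct_sumElim, Matrix.mul_add, mul_vecMulVec, trace_add,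
          trace_vecMulVec, dotProduct_add]
        rw [dotProduct_comm v, dotProduct_comm v, dotProduct_comm w, dotProduct_comm w]
        ring
      have h4 : x ⬝ᵥ x = (vecMulVec v v).trace + (vecMulVec w w).trace := by
        conv_lhs => rw [hx']
        simp only [sumElim_dotProduct_sumElim, trace_vecMulVec]
      rw [h3, h2, ← h4, ← hΦ]
      have h5 : u / c * (x ⬝ᵥ x) = u / r := by
        simp only [r]; field_simp
      rw [h5, sub_pos, div_lt_iff₀ hr]
      linarith
  have hPd : P.PosDef := by
    refine .of_dotProduct_mulVec_pos hP fun x hx => ?_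
    have h1 := hM.dotProduct_mulVec_pos (x := Sum.elim x 0) (fun h => hx (by
      ext i; simpa using congrFun h (Sum.inl i)))
    simpa [fromBlocks_mulVec, star_trivial] using h1
  have h1 := trace_add_trace_add_trace_nonneg hPd hM.posSemidef hABC hC
  rw [hL A B C hA.1 hB hC.1, ← hc, div_mul_cancel₀ _ h0.ne'] at h1
  linarith

end GramMatrix

/-! ### From Gram matrices to sums of squares of forms -/

theorem MvPolynomial.IsHomogeneous.eval_smul {σ : Type*} {f : MvPolynomial σ ℝ} {d : ℕ}
    (hf : f.IsHomogeneous d) (t : ℝ) (v : σ → ℝ) : eval (t • v) f = t ^ d * eval v f := by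
  rw [eval_eq, eval_eq, Finset.mul_sum]
  refine Finset.sum_congr rfl fun s hs => ?_
  have h : d = ∑ i ∈ s.support, s i := hf.degree_eq_sum_deg_support hs
  simp only [Pi.smul_apply, smul_eq_mul, mul_pow, Finset.prod_mul_distrib,
    Finset.prod_pow_eq_pow_sum]
  rw [← h]
  ring

theorem MvPolynomial.IsHomogeneous.exists_isHermitian_eval {σ : Type*} [Fintype σ] [DecidableEq σ]
    {f : MvPolynomial σ ℝ} (hf : f.IsHomogeneous 2) :
    ∃ A : Matrix σ σ ℝ, A.IsHermitian ∧ ∀ v, eval v f = v ⬝ᵥ (A.mulVec v) := by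
  have key : ∃ A : Matrix σ σ ℝ, ∀ v, eval v f = v ⬝ᵥ (A.mulVec v) := by
    have hf' := hf
    rw [← mem_homogeneousSubmodule, ← homogeneousSubmodule_one_pow,
      homogeneousSubmodule_one_eq_span_X, pow_two] at hf'
    refine Submodule.mul_induction_on hf' ?_ ?_
    · have hlin : ∀ g ∈ Submodule.span ℝ (Set.range (X : σ → MvPolynomial σ ℝ)),
          ∃ a : σ → ℝ, ∀ v, eval v g = a ⬝ᵥ v := by
        intro g hg
        induction hg using Submodule.span_induction with
        | mem g hg =>
          obtain ⟨i, rfl⟩ := hg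
          exact ⟨Pi.single i 1, fun v => by simp⟩
        | zero => exact ⟨0, by simp⟩
        | add g k _ _ hg hk =>
          obtain ⟨a, ha⟩ := hg
          obtain ⟨b, hb⟩ := hk
          exact ⟨a + b, fun v => by rw [map_add, ha, hb, add_dotProduct]⟩
        | smul r g _ hg =>
          obtain ⟨a, ha⟩ := hg
          exact ⟨r • a, fun v => by rw [smul_eval, ha, smul_dotProduct, smul_eq_mul]⟩
      intro g hg k hk
      obtain ⟨a, ha⟩ := hlin g hg
      obtain ⟨b, hb⟩ := hlin k hk
      refine ⟨Matrix.vecMulVec a b, fun v => ?_⟩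
      rw [map_mul, ha, hb, Matrix.vecMulVec_mulVec]
      simp [dotProduct_smul, dotProduct_comm]
      ring
    · rintro g k ⟨A, hA⟩ ⟨B, hB⟩
      exact ⟨A + B, fun v => by rw [map_add, hA, hB, Matrix.add_mulVec, dotProduct_add]⟩
  obtain ⟨A, hA⟩ := key
  refine ⟨(1 / 2 : ℝ) • (A + A.transpose), ?_, fun v => ?_⟩
  · rw [Matrix.IsHermitian, Matrix.conjTranspose_eq_transpose_of_trivial]
    simp [add_comm]
  · rw [hA, Matrix.smul_mulVec, Matrix.add_mulVec, dotProduct_smul, dotProduct_add,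
      Matrix.mulVec_transpose, dotProduct_comm v (Matrix.vecMul v A), ← Matrix.dotProduct_mulVec,
      smul_eq_mul]
    ring

theorem isSumOfSquaresOfForms_of_equiv {σ ι : Type*} [Fintype ι] {d k : ℕ} (e : Fin k ≃ ι)
    {f : MvPolynomial σ ℝ} (q : ι → MvPolynomial σ ℝ) (hq : ∀ i, (q i).IsHomogeneous d)
    (hf : f = ∑ i, q i ^ 2) : IsSumOfSquaresOfForms d k f :=
  ⟨q ∘ e, fun i => hq _, by rw [hf]; exact (e.sum_comp fun i => q i ^ 2).symm⟩

/-- A psd quadratic form in `k` variables is a sum of squares of `k` linear forms. -/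
theorem IsPSD.isSumOfSquaresOfForms {σ : Type*} [Fintype σ] {k : ℕ} (e : Fin k ≃ σ)
    {f : MvPolynomial σ ℝ} (hf : f.IsHomogeneous 2) (hpsd : IsPSD f) :
    IsSumOfSquaresOfForms 1 k f := by
  classical
  obtain ⟨A, hA, hAf⟩ := hf.exists_isHermitian_eval
  have hA' : A.PosSemidef := .of_dotProduct_mulVec_nonneg hA fun v => by
    rw [star_trivial, ← hAf]; exact hpsd v
  obtain ⟨B, rfl⟩ := hA'.exists_transpose_mul_self
  refine isSumOfSquaresOfForms_of_equiv e (fun i => ∑ j, C (B i j) * X j)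
    (fun i => .sum _ _ _ fun j _ => isHomogeneous_C_mul_X _ _) (MvPolynomial.funext fun v => ?_)
  rw [hAf, ← Matrix.mulVec_mulVec, Matrix.dotProduct_mulVec, Matrix.vecMul_transpose]
  simp [dotProduct, Matrix.mulVec, sq]

theorem eval_biquadraticPart {p : ℕ} (h₂ h₃ h₄ : MvPolynomial (Fin p) ℝ)
    (v : TriVar p 1 → ℝ) : eval v (biquadraticPart h₂ h₃ h₄) =
      eval (v ∘ TriVar.x) h₂ * v TriVar.z ^ 2
        + eval (v ∘ TriVar.x) h₃ * v (TriVar.y 0) * v TriVar.z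
        + eval (v ∘ TriVar.x) h₄ * v (TriVar.y 0) ^ 2 := by
  simp [biquadraticPart, eval_rename]

/-- A psd biquadratic form in `2 × p` variables is a sum of squares of `2 p` quadratic forms. -/
theorem isSumOfSquaresOfForms_biquadraticPart {p : ℕ} {h₂ h₃ h₄ : MvPolynomial (Fin p) ℝ}
    (H₂ : h₂.IsHomogeneous 2) (H₃ : h₃.IsHomogeneous 2) (H₄ : h₄.IsHomogeneous 2)
    (hpsd : ∀ (a : Fin p → ℝ) (b c : ℝ),
      0 ≤ eval a h₂ * c ^ 2 + eval a h₃ * b * c + eval a h₄ * b ^ 2) :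
    IsSumOfSquaresOfForms 2 (2 * p) (biquadraticPart h₂ h₃ h₄) := by
  obtain ⟨A, hA, hA₂⟩ := H₂.exists_isHermitian_eval
  obtain ⟨B, hB, hB₃⟩ := H₃.exists_isHermitian_eval
  obtain ⟨D, hD, hD₄⟩ := H₄.exists_isHermitian_eval
  obtain ⟨G, hG, rfl, rfl, rfl⟩ := Matrix.exists_posSemidef_gram (A := A) (B := B) (C := D) hB
    -- The chart `(y, z) = (s, 1)` of the projective line; the point at infinity `(1, 0)` gives the
    -- condition on the leading coefficient.
    (fun s => by
      refine .of_dotProduct_mulVec_nonneg ?_ fun v => ?_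
      · refine (hA.add ?_).add ?_
        · exact hB.smul (IsSelfAdjoint.all s)
        · exact hD.smul (IsSelfAdjoint.all _)
      · have h := hpsd v s 1
        rw [hA₂, hB₃, hD₄] at h
        simp only [star_trivial, Matrix.add_mulVec, Matrix.smul_mulVec, dotProduct_add,
          dotProduct_smul, smul_eq_mul]
        linarith)
    (.of_dotProduct_mulVec_nonneg hD fun v => by
      have h := hpsd v 1 0
      rw [hA₂, hB₃, hD₄] at h
      rw [star_trivial]
      linarith)
  obtain ⟨M, hM⟩ := hG.exists_transpose_mul_self
  have e : Fin (2 * p) ≃ Fin p ⊕ Fin p := (finCongr (two_mul p)).trans finSumFinEquiv.symm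
  -- The squared forms are the entries of `M` applied to the vector `(z x, y x)`.
  refine isSumOfSquaresOfForms_of_equiv e
    (fun k => ∑ i, (C (M k (Sum.inl i)) * X (TriVar.x i) * X TriVar.z
      + C (M k (Sum.inr i)) * X (TriVar.x i) * X (TriVar.y 0)))
    (fun k => .sum _ _ _ fun i _ => ((isHomogeneous_C_mul_X _ _).mul (isHomogeneous_X _ _)).add
      ((isHomogeneous_C_mul_X _ _).mul (isHomogeneous_X _ _))) (MvPolynomial.funext fun v => ?_)
  set a : Fin p → ℝ := v ∘ TriVar.x
  set b := v (TriVar.y 0)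
  set c := v TriVar.z
  have h1 : (∑ k, (M.mulVec (Sum.elim (c • a) (b • a)) k) ^ 2) =
      Sum.elim (c • a) (b • a) ⬝ᵥ G.mulVec (Sum.elim (c • a) (b • a)) := by
    rw [hM, ← Matrix.mulVec_mulVec, Matrix.dotProduct_mulVec, Matrix.vecMul_transpose]
    simp [dotProduct, sq]
  have h2 : Sum.elim (c • a) (b • a) ⬝ᵥ G.mulVec (Sum.elim (c • a) (b • a)) =
      c ^ 2 * (a ⬝ᵥ G.toBlocks₁₁.mulVec a) + b * c * (a ⬝ᵥ (G.toBlocks₁₂ + G.toBlocks₂₁).mulVec a)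
        + b ^ 2 * (a ⬝ᵥ G.toBlocks₂₂.mulVec a) := by
    conv_lhs => rw [← Matrix.fromBlocks_toBlocks G]
    rw [Matrix.fromBlocks_mulVec, sumElim_dotProduct_sumElim]
    simp only [Sum.elim_comp_inl, Sum.elim_comp_inr, Matrix.mulVec_smul, dotProduct_add,
      smul_dotProduct, dotProduct_smul, smul_eq_mul, Matrix.add_mulVec]
    ring
  rw [eval_biquadraticPart, hA₂, hB₃, hD₄]
  have h3 : ∀ k, eval v (∑ i, (C (M k (Sum.inl i)) * X (TriVar.x i) * X TriVar.z
      + C (M k (Sum.inr i)) * X (TriVar.x i) * X (TriVar.y 0)) : MvPolynomial (TriVar p 1) ℝ)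
      = M.mulVec (Sum.elim (c • a) (b • a)) k := by
    intro k
    simp only [map_sum, map_add, map_mul, eval_C, eval_X, Matrix.mulVec, dotProduct,
      Fintype.sum_sum_type, Sum.elim_inl, Sum.elim_inr, Finset.sum_add_distrib, Pi.smul_apply,
      smul_eq_mul]
    congr 1 <;> exact Finset.sum_congr rfl fun i _ => by simp only [a, b, c, Function.comp]; ring
  rw [map_sum]
  simp only [map_pow, h3]
  rw [h1, h2]
  ring

/-! ### Nonnegative polynomials in one variable -/

theorem nonneg_of_forall_ne_zero_quadratic_nonneg {a b c : ℝ}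
    (h : ∀ t : ℝ, t ≠ 0 → 0 ≤ a + b * t + c * t ^ 2) : 0 ≤ a := by
  have hc : Filter.Tendsto (fun t : ℝ => a + b * t + c * t ^ 2) (nhdsWithin 0 {0}ᶜ) (nhds a) := by
    have : Continuous fun t : ℝ => a + b * t + c * t ^ 2 := by fun_prop
    have h0 := this.tendsto 0
    simp only [mul_zero, add_zero, ne_eq, OfNat.ofNat_ne_zero, not_false_eq_true, zero_pow] at h0
    exact h0.mono_left nhdsWithin_le_nhds
  exact ge_of_tendsto hc (by filter_upwards [self_mem_nhdsWithin] with t ht using h t ht)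

theorem eq_zero_of_forall_linear_add_sq_nonneg {b c : ℝ}
    (h : ∀ t : ℝ, 0 ≤ b * t + c * t ^ 2) : b = 0 := by
  by_contra hb
  have hs : 0 < |c| + 1 := by positivity
  -- The denominator exceeds `c`, so the linear term wins and the value is negative.
  have h2 := h (-b / (|c| + 1))
  have h3 : b * (-b / (|c| + 1)) + c * (-b / (|c| + 1)) ^ 2
      = b ^ 2 / (|c| + 1) ^ 2 * (c - (|c| + 1)) := by field_simp; ring
  rw [h3] at h2
  have h4 : 0 < b ^ 2 / (|c| + 1) ^ 2 := by positivity
  nlinarith [le_abs_self c]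

/-! ### Normal form of a degenerated tripartite quartic -/

section TripartiteForm

variable {p : ℕ}

/-- The expression of `IsExpressedBy` together with the two terms of degree three in `z`. -/
structure IsCubicExpressedBy (h : MvPolynomial (TriVar p 1) ℝ)
    (h₁ h₂ h₃ h₄ h₅ h₆ : MvPolynomial (Fin p) ℝ) (h₇ c : ℝ) : Prop where
  linear₁ : h₁.IsHomogeneous 1
  expressed : IsExpressedBy (h - rename TriVar.x h₁ * X TriVar.z ^ 3
    - C c * X (TriVar.y 0) * X TriVar.z ^ 3) h₂ h₃ h₄ h₅ h₆ h₇

theorem monomial_triVar (s : TriVar p 1 →₀ ℕ) (r : ℝ) :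
    monomial s r = rename TriVar.x (monomial (Finsupp.equivFunOnFinite.symm
      (fun i => s (TriVar.x i))) r) * X (TriVar.y 0) ^ s (TriVar.y 0) * X TriVar.z ^ s TriVar.z := by
  have hs : s = (Finsupp.equivFunOnFinite.symm (fun i => s (TriVar.x i))).mapDomain
      (TriVar.x : Fin p → TriVar p 1) + Finsupp.single (TriVar.y 0) (s (TriVar.y 0))
        + Finsupp.single TriVar.z (s TriVar.z) := by
    ext i
    rcases i with i | j | u
    · simp [Finsupp.mapDomain_apply Sum.inl_injective]
    · obtain rfl := Subsingleton.elim j 0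
      simp [Finsupp.mapDomain_of_notMem_range]
    · simp [Finsupp.mapDomain_of_notMem_range]
  rw [rename_monomial, X_pow_eq_monomial, X_pow_eq_monomial, monomial_mul, monomial_mul, ← hs]
  simp

/-- Such expressions add, so single monomials suffice. With x-degree and y-degree each at most 2
there are nine bidegrees; the missing `z ^ 4` excludes (0, 0), and each of the other eight belongs
to one slot. -/
theorem exists_isCubicExpressedBy {h : MvPolynomial (TriVar p 1) ℝ}
    (hh : IsTripartiteQuarticForm h) (hz : coeff (Finsupp.single TriVar.z 4) h = 0) :
    ∃ (h₁ h₂ h₃ h₄ h₅ h₆ : MvPolynomial (Fin p) ℝ) (h₇ c : ℝ),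
      IsCubicExpressedBy h h₁ h₂ h₃ h₄ h₅ h₆ h₇ c := by
  rw [h.as_sum]
  refine Finset.sum_induction _ (fun g => ∃ (h₁ h₂ h₃ h₄ h₅ h₆ : MvPolynomial (Fin p) ℝ)
    (h₇ c : ℝ), IsCubicExpressedBy g h₁ h₂ h₃ h₄ h₅ h₆ h₇ c) ?_ ?_ ?_
  · rintro f g ⟨f₁, f₂, f₃, f₄, f₅, f₆, f₇, c, hf₁, hf⟩ ⟨g₁, g₂, g₃, g₄, g₅, g₆, g₇, d, hg₁, hg⟩
    refine ⟨f₁ + g₁, f₂ + g₂, f₃ + g₃, f₄ + g₄, f₅ + g₅, f₆ + g₆, f₇ + g₇, c + d,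
      hf₁.add hg₁, hf.1.add hg.1, hf.2.add hg.2, hf.3.add hg.3, hf.4.add hg.4, hf.5.add hg.5, ?_⟩
    have h1 := hf.eq
    have h2 := hg.eq
    rw [biquadraticPart] at h1 h2 ⊢
    simp only [map_add]
    linear_combination h1 + h2
  · have hz (d : ℕ) : (0 : MvPolynomial (Fin p) ℝ).IsHomogeneous d := isHomogeneous_zero _ _ _
    exact ⟨0, 0, 0, 0, 0, 0, 0, 0, hz 1, hz 2, hz 2, hz 2, hz 1, hz 1, by simp [biquadraticPart]⟩
  · intro s hs
    have hz0 (d : ℕ) : (0 : MvPolynomial (Fin p) ℝ).IsHomogeneous d := isHomogeneous_zero _ _ _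
    obtain ⟨hx, hy⟩ := hh.2 s hs
    have hdeg : s.degree = 4 := by
      rw [Finsupp.degree_apply]; exact (hh.1.degree_eq_sum_deg_support hs).symm
    have hne : s ≠ Finsupp.single TriVar.z 4 := by
      rintro rfl
      exact (mem_support_iff.1 hs) hz
    set r := coeff s h
    set a : Fin p →₀ ℕ := Finsupp.equivFunOnFinite.symm (fun i => s (TriVar.x i)) with ha
    have hm := monomial_triVar s r
    rw [← ha] at hm
    have had : a.degree = ∑ i, s (TriVar.x i) := by rw [Finsupp.degree_eq_sum]; rfl
    have hsum : a.degree + s (TriVar.y 0) + s TriVar.z = 4 := by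
      rw [had, ← hdeg, Finsupp.degree_eq_sum]
      simp [add_assoc]
    have hy' : s (TriVar.y 0) ≤ 2 := by simpa using hy
    rw [← had] at hx
    have hhom : ∀ d, a.degree = d → (monomial a r).IsHomogeneous d :=
      fun d hd => isHomogeneous_monomial r hd
    have hconst : a.degree = 0 → rename TriVar.x (monomial a r) =
        (C r : MvPolynomial (TriVar p 1) ℝ) := fun h0 => by
      rw [(Finsupp.degree_eq_zero_iff a).1 h0]; exact rename_C _ _
    have hab : ¬ (a.degree = 0 ∧ s (TriVar.y 0) = 0) := by
      rintro ⟨h0, h1⟩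
      refine hne (Finsupp.ext fun i => ?_)
      rcases i with i | j | u
      · simpa [ha] using DFunLike.congr_fun ((Finsupp.degree_eq_zero_iff a).1 h0) i
      · obtain rfl := Subsingleton.elim j 0
        simpa using h1
      · have h2 : s TriVar.z = 4 := by omega
        simpa using h2
    rw [hm]
    generalize s (TriVar.y 0) = b at *
    generalize hc : s TriVar.z = c at *
    generalize hα : a.degree = α at *
    obtain rfl : c = 4 - α - b := by omega
    interval_cases α <;> interval_cases b
    · exact absurd ⟨rfl, rfl⟩ hab
    · exact ⟨0, 0, 0, 0, 0, 0, 0, r, hz0 1, hz0 2, hz0 2, hz0 2, hz0 1, hz0 1,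
        by simp [biquadraticPart, hconst]⟩
    · exact ⟨0, 0, 0, 0, 0, 0, r, 0, hz0 1, hz0 2, hz0 2, hz0 2, hz0 1, hz0 1,
        by simp [biquadraticPart, hconst]⟩
    · exact ⟨monomial a r, 0, 0, 0, 0, 0, 0, 0, hhom 1 rfl, hz0 2, hz0 2, hz0 2, hz0 1, hz0 1,
        by simp [biquadraticPart]⟩
    · exact ⟨0, 0, 0, 0, monomial a r, 0, 0, 0, hz0 1, hz0 2, hz0 2, hz0 2, hhom 1 rfl, hz0 1,
        by simp [biquadraticPart]⟩
    · exact ⟨0, 0, 0, 0, 0, monomial a r, 0, 0, hz0 1, hz0 2, hz0 2, hz0 2, hz0 1, hhom 1 rfl,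
        by simp [biquadraticPart]⟩
    · exact ⟨0, monomial a r, 0, 0, 0, 0, 0, 0, hz0 1, hhom 2 rfl, hz0 2, hz0 2, hz0 1, hz0 1,
        by simp [biquadraticPart]⟩
    · exact ⟨0, 0, monomial a r, 0, 0, 0, 0, 0, hz0 1, hz0 2, hhom 2 rfl, hz0 2, hz0 1, hz0 1,
        by simp [biquadraticPart]⟩
    · exact ⟨0, 0, 0, monomial a r, 0, 0, 0, 0, hz0 1, hz0 2, hz0 2, hhom 2 rfl, hz0 1, hz0 1,
        by simp [biquadraticPart]⟩

theorem IsExpressedBy.eval_point {h : MvPolynomial (TriVar p 1) ℝ}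
    {h₂ h₃ h₄ h₅ h₆ : MvPolynomial (Fin p) ℝ} {h₇ : ℝ} (H : IsExpressedBy h h₂ h₃ h₄ h₅ h₆ h₇)
    (a : Fin p → ℝ) (b : Fin 1 → ℝ) (c : ℝ) : eval (TriVar.point a b c) h =
      eval a h₂ * c ^ 2 + eval a h₃ * b 0 * c + eval a h₄ * b 0 ^ 2
        + eval a h₅ * b 0 * c ^ 2 + eval a h₆ * b 0 ^ 2 * c + h₇ * b 0 ^ 2 * c ^ 2 := by
  have hx : TriVar.point a b c ∘ TriVar.x = a := rfl
  rw [H.eq]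
  simp only [map_add, map_mul, map_pow, eval_biquadraticPart, eval_rename, eval_C, eval_X, hx]
  rfl

theorem IsDegenerated.exists_isExpressedBy {h : MvPolynomial (TriVar p 1) ℝ}
    (hh : IsDegenerated h) : ∃ (h₂ h₃ h₄ h₅ h₆ : MvPolynomial (Fin p) ℝ) (h₇ : ℝ),
      IsExpressedBy h h₂ h₃ h₄ h₅ h₆ h₇ := by
  obtain ⟨hq, hz, hpsd⟩ := hh
  obtain ⟨h₁, h₂, h₃, h₄, h₅, h₆, h₇, c, H₁, H⟩ := exists_isCubicExpressedBy hq hz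
  have hev : ∀ (a : Fin p → ℝ) (b d : ℝ), 0 ≤ eval a h₁ * d ^ 3 + c * b * d ^ 3
      + (eval a h₂ * d ^ 2 + eval a h₃ * b * d + eval a h₄ * b ^ 2
        + eval a h₅ * b * d ^ 2 + eval a h₆ * b ^ 2 * d + h₇ * b ^ 2 * d ^ 2) := by
    intro a b d
    have h1 := H.eval_point a (fun _ => b) d
    have h2 := hpsd (TriVar.point a (fun _ => b) d)
    have hx : TriVar.point a (fun _ : Fin 1 => b) d ∘ TriVar.x = a := rfl
    simp only [map_sub, map_mul, map_pow, eval_rename, eval_C, eval_X, hx] at h1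
    simp only [TriVar.point, Sum.elim_inr, Sum.elim_inl] at h1 h2
    linarith
  -- On `y = 0`, `z = 1` the form is `h₁(a) t + h₂(a) t²` along the line through `a`.
  have h1z : h₁ = 0 := by
    refine MvPolynomial.funext fun a => ?_
    rw [map_zero]
    refine eq_zero_of_forall_linear_add_sq_nonneg (c := eval a h₂) fun t => ?_
    have h1 := hev (t • a) 0 1
    rw [H₁.eval_smul, H.1.eval_smul] at h1
    linarith
  have hcz : c = 0 := by
    refine eq_zero_of_forall_linear_add_sq_nonneg (c := h₇) fun t => ?_
    -- The origin is written `0 • 0` so that homogeneity evaluates every form there to zero.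
    have h1 := hev ((0 : ℝ) • 0) t 1
    rw [H₁.eval_smul, H.1.eval_smul, H.2.eval_smul, H.3.eval_smul, H.4.eval_smul,
      H.5.eval_smul] at h1
    linarith
  subst h1z hcz
  exact ⟨h₂, h₃, h₄, h₅, h₆, h₇, by simpa using H⟩

theorem isHomogeneous_borderedQuadratic {q l : MvPolynomial (Fin p) ℝ} (hq : q.IsHomogeneous 2)
    (hl : l.IsHomogeneous 1) (c : ℝ) : (borderedQuadratic q l c).IsHomogeneous 2 :=
  (hq.rename_isHomogeneous.add (hl.rename_isHomogeneous.mul (isHomogeneous_X _ _))).add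
    (isHomogeneous_C_mul_X_pow _ _ _)

theorem isPSD_borderedQuadratic {q l : MvPolynomial (Fin p) ℝ} {c : ℝ}
    (h : ∀ (a : Fin p → ℝ) (t : ℝ), 0 ≤ eval a q + eval a l * t + c * t ^ 2) :
    IsPSD (borderedQuadratic q l c) := fun v => by
  simpa [borderedQuadratic, eval_rename] using h (v ∘ Sum.inl) (v (Sum.inr ()))

/-- The substitution `a ↦ -a` separates the even part from the odd part. -/
theorem eq_zero_of_forall_eval_add_eq_zero {f g : MvPolynomial (Fin p) ℝ}
    (hf : f.IsHomogeneous 2) (hg : g.IsHomogeneous 1) (h : ∀ a, eval a f + eval a g = 0) :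
    f = 0 ∧ g = 0 := by
  have key : ∀ a, eval a f = 0 ∧ eval a g = 0 := fun a => by
    have h1 := h a
    have h2 := h ((-1 : ℝ) • a)
    rw [hf.eval_smul, hg.eval_smul] at h2
    constructor <;> linarith
  exact ⟨MvPolynomial.funext fun a => by rw [(key a).1, map_zero],
    MvPolynomial.funext fun a => by rw [(key a).2, map_zero]⟩

end TripartiteForm

/-! ### The main theorem -/

theorem proposition3p1 (m : ℕ) (hm : 2 ≤ m) (h : MvPolynomial (TriVar (m - 1) 1) ℝ)
    (hh : IsDegenerated h) :
    (∃ (h₂ h₃ h₄ h₅ h₆ : MvPolynomial (Fin (m - 1)) ℝ) (h₇ : ℝ),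
      IsExpressedBy h h₂ h₃ h₄ h₅ h₆ h₇) ∧
    ∀ (h₂ h₃ h₄ h₅ h₆ : MvPolynomial (Fin (m - 1)) ℝ) (h₇ : ℝ),
      IsExpressedBy h h₂ h₃ h₄ h₅ h₆ h₇ →
      -- (i)
      (0 ≤ h₇ ∧ (h₇ = 0 → h₅ = 0 ∧ h₆ = 0)) ∧
      -- (ii)
      (IsSumOfSquaresOfForms 1 (m - 1) h₂ ∧ (h₂ = 0 → h₃ = 0 ∧ h₅ = 0)) ∧
      -- (iii)
      (IsSumOfSquaresOfForms 1 (m - 1) h₄ ∧ (h₄ = 0 → h₃ = 0 ∧ h₆ = 0)) ∧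
      -- (iv)
      (IsSumOfSquaresOfForms 1 m (borderedQuadratic h₂ h₅ h₇) ∧
        IsSumOfSquaresOfForms 1 m (borderedQuadratic h₄ h₆ h₇)) ∧
      -- (v)
      (IsSOS (biquadraticPart h₂ h₃ h₄) ∧
        sosRank (biquadraticPart h₂ h₃ h₄) ≤ 2 * (m - 1)) ∧
      -- (vi)
      (IsNontrivialZero h (TriVar.point 0 1 0) ∧ IsNontrivialZero h (TriVar.point 0 0 1) ∧
        (TriVar.point 0 1 0 : TriVar (m - 1) 1 → ℝ) ≠ TriVar.point 0 0 1) := by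
  refine ⟨hh.exists_isExpressedBy, fun h₂ h₃ h₄ h₅ h₆ h₇ H => ?_⟩
  have hev : ∀ (a : Fin (m - 1) → ℝ) (b c : ℝ), 0 ≤
      eval a h₂ * c ^ 2 + eval a h₃ * b * c + eval a h₄ * b ^ 2
        + eval a h₅ * b * c ^ 2 + eval a h₆ * b ^ 2 * c + h₇ * b ^ 2 * c ^ 2 := fun a b c => by
    rw [← H.eval_point a (fun _ => b) c]
    exact hh.2.2 _
  have e2 := H.quadratic₂.eval_smul
  have e3 := H.quadratic₃.eval_smul
  have e4 := H.quadratic₄.eval_smul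
  have e5 := H.linear₅.eval_smul
  have e6 := H.linear₆.eval_smul
  -- Divide `h(a, tb, tc)` by `t²` and let `t → 0`.
  have hbi : ∀ (a : Fin (m - 1) → ℝ) (b c : ℝ),
      0 ≤ eval a h₂ * c ^ 2 + eval a h₃ * b * c + eval a h₄ * b ^ 2 := fun a b c => by
    refine nonneg_of_forall_ne_zero_quadratic_nonneg
      (b := eval a h₅ * b * c ^ 2 + eval a h₆ * b ^ 2 * c) (c := h₇ * b ^ 2 * c ^ 2)
      fun t ht => ?_
    have h1 := hev a (t * b) (t * c)
    have ht2 : 0 < t ^ 2 := by positivity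
    refine nonneg_of_mul_nonneg_right (h1.trans_eq ?_) ht2
    ring
  -- Multiply `h(a, t, 1/s)` by `s²` and let `s → 0`; `hb46` does the same with `y` and `z`
  -- exchanged.
  have hb25 : ∀ (a : Fin (m - 1) → ℝ) (t : ℝ),
      0 ≤ eval a h₂ + eval a h₅ * t + h₇ * t ^ 2 := fun a t => by
    refine nonneg_of_forall_ne_zero_quadratic_nonneg
      (b := eval a h₃ * t + eval a h₆ * t ^ 2) (c := eval a h₄ * t ^ 2) fun s hs => ?_
    have hs2 : 0 < s ^ 2 := by positivity
    refine (mul_nonneg hs2.le (hev a t s⁻¹)).trans_eq ?_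
    field_simp
    ring
  have hb46 : ∀ (a : Fin (m - 1) → ℝ) (t : ℝ),
      0 ≤ eval a h₄ + eval a h₆ * t + h₇ * t ^ 2 := fun a t => by
    refine nonneg_of_forall_ne_zero_quadratic_nonneg
      (b := eval a h₃ * t + eval a h₅ * t ^ 2) (c := eval a h₂ * t ^ 2) fun s hs => ?_
    have hs2 : 0 < s ^ 2 := by positivity
    refine (mul_nonneg hs2.le (hev a s⁻¹ t)).trans_eq ?_
    field_simp
    ring
  have em : Fin m ≃ Fin (m - 1) ⊕ Unit :=
    Fintype.equivOfCardEq (by simp; omega)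
  have hsos := isSumOfSquaresOfForms_biquadraticPart H.quadratic₂ H.quadratic₃ H.quadratic₄ hbi
  refine ⟨⟨?_, ?_⟩, ⟨?_, ?_⟩, ⟨?_, ?_⟩, ⟨?_, ?_⟩, ⟨⟨_, hsos⟩, Nat.sInf_le hsos⟩,
    ⟨?_, ?_⟩, ⟨?_, ?_⟩, ?_⟩
  · have h1 := hb25 ((0 : ℝ) • 0) 1
    rw [e2, e5] at h1
    linarith
  · rintro rfl
    -- With `h₇ = 0`, the restrictions to `(y, z) = (1, ±1)` have no constant term, and their linear
    -- parts are `h₅ ± h₆`.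
    have key : ∀ a, eval a h₅ = 0 ∧ eval a h₆ = 0 := fun a => by
      have h1 := eq_zero_of_forall_linear_add_sq_nonneg (b := eval a h₅ + eval a h₆)
        (c := eval a h₂ + eval a h₃ + eval a h₄) fun t => by
          have h1 := hev (t • a) 1 1
          rw [e2, e3, e4, e5, e6] at h1
          linarith
      have h2 := eq_zero_of_forall_linear_add_sq_nonneg (b := eval a h₅ - eval a h₆)
        (c := eval a h₂ - eval a h₃ + eval a h₄) fun t => by
          have h1 := hev (t • a) 1 (-1)
          rw [e2, e3, e4, e5, e6] at h1
          linarith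
      constructor <;> linarith
    exact ⟨MvPolynomial.funext fun a => by rw [(key a).1, map_zero],
      MvPolynomial.funext fun a => by rw [(key a).2, map_zero]⟩
  · exact IsPSD.isSumOfSquaresOfForms (Equiv.refl _) H.quadratic₂ fun a => by
      simpa using hbi a 0 1
  · rintro rfl
    refine eq_zero_of_forall_eval_add_eq_zero H.quadratic₃ H.linear₅ fun a => ?_
    -- With `h₂ = 0`, the value at `(a, t, 1)` has no constant term in `t`, and its linear
    -- coefficient is `h₃(a) + h₅(a)`.
    refine eq_zero_of_forall_linear_add_sq_nonneg (c := eval a h₄ + eval a h₆ + h₇) fun t => ?_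
    have h1 := hev a t 1
    rw [map_zero] at h1
    linarith
  · exact IsPSD.isSumOfSquaresOfForms (Equiv.refl _) H.quadratic₄ fun a => by
      simpa using hbi a 1 0
  · rintro rfl
    refine eq_zero_of_forall_eval_add_eq_zero H.quadratic₃ H.linear₆ fun a => ?_
    refine eq_zero_of_forall_linear_add_sq_nonneg (c := eval a h₂ + eval a h₅ + h₇) fun t => ?_
    have h1 := hev a 1 t
    rw [map_zero] at h1
    linarith
  · exact (isPSD_borderedQuadratic hb25).isSumOfSquaresOfForms em
      (isHomogeneous_borderedQuadratic H.quadratic₂ H.linear₅ _)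
  · exact (isPSD_borderedQuadratic hb46).isSumOfSquaresOfForms em
      (isHomogeneous_borderedQuadratic H.quadratic₄ H.linear₆ _)
  · intro h0
    simpa [TriVar.point] using congrFun h0 (TriVar.y 0)
  · have h4 := e4 0 0
    rw [zero_smul] at h4
    rw [H.eval_point, h4]
    simp
  · intro h0
    simpa [TriVar.point] using congrFun h0 TriVar.z
  · have h2 := e2 0 0
    rw [zero_smul] at h2
    rw [H.eval_point, h2]
    simp
  · intro h0
    simpa [TriVar.point] using congrFun h0 TriVar.z
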